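/- Let $l<k$ be positive integers, $d=\gcd(l,k)$, and write $k=nd$ (so $n>1$). For $a\in\mathrm{GF}(2^k)$ let $P_a(x)=x^{2^l+1}+x+a$. Define polynomials over $\mathrm{GF}(2^k)$ by $C_1(x)=C_2(x)=1$, $C_{i+2}(x)=C_{i+1}(x)+x^{2^{il}}C_i(x)$ for $1\le i\le n-1$, and let $$Z_n(x)=C_{n+1}(x)+x\,C_{n-1}(x)^{2^l}.$$ Let $M_i$ denote the number of $a\in\mathrm{GF}(2^k)^*$ such that $P_a$ has exactly $i$ zeros in $\mathrm{GF}(2^k)$. Then: (1) for every $a\in\mathrm{GF}(2^k)^*$, the polynomial $P_a$ has either no zeros or exactly two zeros in $\mathrm{GF}(2^k)$ if and only if $Z_n(a)\neq 0$; (2) if $n$ is odd, then $$M_0=\frac{(2^k+1)2^{d-1}}{2^d+1};$$ if $n$ is even, then $$M_0=\frac{(2^k-1)2^{d-1}}{2^d+1};$$ and in both cases $$M_2=\frac{(2^k-1)(2^{d-1}-1)}{2^d-1}.$$ -/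

import Mathlib

open Polynomial

namespace HellesethKholosha

/-- The polynomial `P_a(x) = x^(2^l+1) + x + a`. -/
noncomputable def P {F : Type*} [Field F] (l : ℕ) (a : F) : F[X] :=
  X ^ (2 ^ l + 1) + X + C a

/-- The polynomials `C_i(x)`: `C_1 = C_2 = 1` and `C_{i+2} = C_{i+1} + x^(2^(i l)) C_i` for `i ≥ 1`.
The sequence starts at index `1`; the value at index `0` is a placeholder. -/
noncomputable def CPoly (F : Type*) [Field F] (l : ℕ) : ℕ → F[X]
  | 0 => 0
  | 1 => 1
  | 2 => 1
  | i + 3 => CPoly F l (i + 2) + X ^ (2 ^ ((i + 1) * l)) * CPoly F l (i + 1)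

/-- The polynomials `Z_n(x)`: `Z_1 = 1` and `Z_n = C_{n+1} + x C_{n-1}^(2^l)` for `n > 1`.
The sequence starts at index `1`; the value at index `0` is a placeholder. -/
noncomputable def ZPoly (F : Type*) [Field F] (l : ℕ) : ℕ → F[X]
  | 0 => 0
  | 1 => 1
  | n + 2 => CPoly F l (n + 3) + X * CPoly F l (n + 1) ^ (2 ^ l)

/-- The number of (distinct) zeros of `P_a` in the field `F`. -/
noncomputable def numZeros {F : Type*} [Field F] (l : ℕ) (a : F) : ℕ :=
  {x : F | (P l a).eval x = 0}.ncard

/-- `M_i`: the number of nonzero `a` in `F` such that `P_a` has exactly `i` zeros in `F`. -/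
noncomputable def M (F : Type*) [Field F] (l i : ℕ) : ℕ :=
  {a : F | a ≠ 0 ∧ numZeros l a = i}.ncard

end HellesethKholosha

/-! Put `σ x = x ^ 2 ^ l`, an automorphism of order `n` whose fixed field has `Q = 2 ^ d` elements,
and let `N` be `sigmaNorm σ n`. In characteristic 2 the zeros of `P_a` are the solutions of `x (σ x
+ 1) = a`, that is, the `x` for which `(x, 1)` spans a line stable under `twistedMap`. The `n`-th
iterate of this map is linear, with trace `Z_n(a)` and determinant `N(a)`. A zero `x` gives it the
eigenvalue `N(x + 1)`, hence also `N(x)`, so `Z_n(a) = N(x) + N(x + 1)` (`trace_eq_of_root`).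
Conversely, trace zero forces a double eigenvalue, and Galois descent then produces a zero
(`exists_root_of_trace_eq_zero`).

Given one zero `x`, the others are `x + 1/u` with `σ(x + 1) σ(u) + x u = 1`. This equation has one
solution if `N(x) ≠ N(x + 1)`, otherwise 0 or `Q`. So `P_a` has 0, 1, 2 or `Q + 1` zeros, and a zero
`x` is one of exactly two iff `N(x) ≠ N(x + 1)`. This yields (1). Counting such `x` by Hilbert 90
gives `M_2`. The first two moments of the number of zeros then determine `M_0`; the parity of `n`
enters through the solvability of `σ w + w = 1`. -/

namespace HellesethKholosha

/-! ### Galois descent and Hilbert 90 for the cyclic group generated by `σ`. -/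

section Descent

variable {F : Type*} [Field F]

/-- For a field endomorphism `σ`, the twisted power `x σ(x) ⋯ σ^(n-1)(x)`. -/
def sigmaNorm (σ : F →+* F) (n : ℕ) (x : F) : F :=
  ∏ i ∈ Finset.range n, (σ ^ i) x

lemma sigmaNorm_mul (σ : F →+* F) (n : ℕ) (x y : F) :
    sigmaNorm σ n (x * y) = sigmaNorm σ n x * sigmaNorm σ n y := by
  simp [sigmaNorm, Finset.prod_mul_distrib]

lemma sigmaNorm_one (σ : F →+* F) (n : ℕ) : sigmaNorm σ n 1 = 1 := by
  simp [sigmaNorm]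

lemma sigmaNorm_inv (σ : F →+* F) (n : ℕ) (x : F) :
    sigmaNorm σ n x⁻¹ = (sigmaNorm σ n x)⁻¹ := by
  simp [sigmaNorm]

lemma sigmaNorm_ne_zero (σ : F →+* F) (n : ℕ) {x : F} (hx : x ≠ 0) :
    sigmaNorm σ n x ≠ 0 := by
  exact Finset.prod_ne_zero_iff.2 fun i _ => (map_ne_zero (σ ^ i)).2 hx

lemma sigmaNorm_succ' (σ : F →+* F) (n : ℕ) (x : F) :
    sigmaNorm σ (n + 1) x = sigmaNorm σ n (σ x) * x := by
  simp [sigmaNorm, Finset.prod_range_succ']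

lemma sigmaNorm_succ (σ : F →+* F) (n : ℕ) (x : F) :
    sigmaNorm σ (n + 1) x = sigmaNorm σ n x * (σ ^ n) x := by
  simp [sigmaNorm, Finset.prod_range_succ]

lemma sigmaNorm_apply {σ : F →+* F} {n : ℕ} (hσ : orderOf σ = n) (x : F) :
    sigmaNorm σ n (σ x) = sigmaNorm σ n x := by
  rcases eq_or_ne x 0 with rfl | hx
  · simp
  · have h1 := sigmaNorm_succ' σ n x
    have h2 := sigmaNorm_succ σ n x
    have h3 : σ ^ n = 1 := hσ ▸ pow_orderOf_eq_one σ
    rw [h3, h1] at h2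
    exact mul_right_cancel₀ hx h2

/-- Independence of the powers of `σ`. -/
lemma exists_sum_mul_pow_apply_ne_zero {σ : F →+* F} {n : ℕ} (hσ : orderOf σ = n)
    (hn : 0 < n) (c : ℕ → F) (hc : c 0 ≠ 0) :
    ∃ t : F, ∑ i ∈ Finset.range n, c i * (σ ^ i) t ≠ 0 := by
  by_contra! h
  have hinj : Function.Injective (fun i : Fin n => ((σ ^ (i : ℕ) : F →+* F) : F →* F)) := by
    intro i j hij
    have : (σ ^ (i : ℕ) : F →+* F) = σ ^ (j : ℕ) :=
      RingHom.ext fun x => DFunLike.congr_fun hij x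
    exact Fin.ext (pow_injOn_Iio_orderOf (by simp [hσ]) (by simp [hσ]) this)
  have hli := (linearIndependent_monoidHom F F).comp _ hinj
  rw [Fintype.linearIndependent_iff] at hli
  refine hc (hli (fun i => c i) ?_ ⟨0, hn⟩)
  ext t
  simpa [Finset.sum_apply, Finset.sum_range] using h t

variable {V : Type*} [AddCommGroup V] [Module F V]

lemma iterate_semilinear_smul {σ : F →+* F} (T : V →ₛₗ[σ] V) (i : ℕ) (t : F) (v : V) :
    T^[i] (t • v) = (σ ^ i) t • T^[i] v := by
  induction i generalizing t v with
  | zero => simp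
  | succ i ih => simp [Function.iterate_succ, ih, pow_succ]

/-- Galois descent: a semilinear map whose `n`-th iterate has a nonzero fixed vector has a nonzero
fixed vector itself. -/
lemma exists_fixed_of_iterate_fixed {σ : F →+* F} {n : ℕ} (hσ : orderOf σ = n) (hn : 0 < n)
    (T : V →ₛₗ[σ] V) {w : V} (hw : w ≠ 0) (hTw : T^[n] w = w) :
    ∃ v : V, v ≠ 0 ∧ T v = v := by
  obtain ⟨f, hf⟩ : ∃ f : Module.Dual F V, f w ≠ 0 := by
    by_contra! h
    exact hw ((Module.forall_dual_apply_eq_zero_iff F w).1 h)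
  -- The scalar `t` keeps `f`, hence the orbit sum of `t • w`, from vanishing.
  obtain ⟨t, ht⟩ := exists_sum_mul_pow_apply_ne_zero hσ hn (fun i => f (T^[i] w)) hf
  refine ⟨∑ i ∈ Finset.range n, T^[i] (t • w), fun h => ht ?_, ?_⟩
  · have := congrArg f h
    simpa [iterate_semilinear_smul, mul_comm] using this
  · have h1 := Finset.sum_range_succ (fun i => T^[i] (t • w)) n
    have h2 := Finset.sum_range_succ' (fun i => T^[i] (t • w)) n
    have h3 : T^[n] (t • w) = t • w := by
      rw [iterate_semilinear_smul, hTw, ← hσ, pow_orderOf_eq_one]; rfl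
    rw [h1, h3] at h2
    rw [map_sum]
    simpa [Function.iterate_succ_apply'] using h2.symm

lemma iterate_smul_semilinear {σ : F →+* F} (T : V →ₛₗ[σ] V) (b : F) (i : ℕ) (v : V) :
    (b • T)^[i] v = sigmaNorm σ i b • T^[i] v := by
  induction i generalizing v with
  | zero => simp [sigmaNorm]
  | succ i ih =>
    rw [Function.iterate_succ_apply, ih, Function.iterate_succ_apply, LinearMap.smul_apply,
      iterate_semilinear_smul, smul_smul, sigmaNorm_succ]

/-- Hilbert's Theorem 90. -/
lemma exists_mul_apply_eq_self {σ : F →+* F} {n : ℕ} (hσ : orderOf σ = n) (hn : 0 < n)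
    {t : F} (ht : sigmaNorm σ n t = 1) : ∃ u : F, u ≠ 0 ∧ t * σ u = u := by
  let S : F →ₛₗ[σ] F :=
    { toFun := σ, map_add' := map_add σ, map_smul' := by simp }
  have hS : ∀ i, S^[i] 1 = 1 := fun i => Function.iterate_fixed (map_one σ) i
  exact exists_fixed_of_iterate_fixed hσ hn (t • S) one_ne_zero
    (by rw [iterate_smul_semilinear, ht, hS, one_smul])

/-- Hilbert's Theorem 90, additive form, for the element `1`. -/
lemma exists_apply_eq_add_one {σ : F →+* F} {n : ℕ} (hσ : orderOf σ = n) (hn : 0 < n)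
    (h0 : (n : F) = 0) : ∃ w : F, σ w = w + 1 := by
  obtain ⟨t, ht⟩ := exists_sum_mul_pow_apply_ne_zero hσ hn (fun _ => 1) one_ne_zero
  simp only [one_mul] at ht
  have hσt : (σ ^ n) t = t := by rw [← hσ, pow_orderOf_eq_one]; rfl
  set τ := ∑ i ∈ Finset.range n, (σ ^ i) t with hτ
  have hs : ∀ i, σ ((σ ^ i) t) = (σ ^ (i + 1)) t := fun i => by rw [pow_succ']; rfl
  have hτσ : σ τ = τ := by
    have h1 := Finset.sum_range_succ (fun i => (σ ^ i) t) n
    have h2 := Finset.sum_range_succ' (fun i => (σ ^ i) t) n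
    rw [h1, hσt] at h2
    rw [hτ, map_sum, Finset.sum_congr rfl fun i _ => hs i]
    exact (add_right_cancel h2).symm
  -- Shifting the index costs one copy of the trace `τ`; the boundary term `n * t` vanishes by `h0`.
  have key : σ (∑ i ∈ Finset.range n, (i : F) * (σ ^ i) t) =
      (∑ i ∈ Finset.range n, (i : F) * (σ ^ i) t) - τ := by
    have h1 := Finset.sum_range_succ (fun i => (i : F) * (σ ^ i) t) n
    have h2 := Finset.sum_range_succ' (fun i => (i : F) * (σ ^ i) t) n
    rw [h1, h0] at h2
    simp only [zero_mul, add_zero, Nat.cast_zero, Nat.cast_add, Nat.cast_one, add_mul, one_mul,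
      Finset.sum_add_distrib] at h2
    have h3 : τ = ∑ i ∈ Finset.range n, (σ ^ (i + 1)) t := by
      rw [← hτσ, hτ, map_sum, Finset.sum_congr rfl fun i _ => hs i]
    rw [← h3] at h2
    rw [map_sum, eq_sub_iff_add_eq, h2]
    simp only [map_mul, map_natCast, hs]
  refine ⟨-(∑ i ∈ Finset.range n, (i : F) * (σ ^ i) t) / τ, ?_⟩
  rw [map_div₀, map_neg, key, hτσ]
  field_simp
  ring

/-- The trace obstruction to `σ w = w + 1`. -/
lemma natCast_eq_zero_of_apply_eq_add_one {σ : F →+* F} {n : ℕ} (hσ : orderOf σ = n)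
    {w : F} (hw : σ w = w + 1) : (n : F) = 0 := by
  have h : ∀ i : ℕ, (σ ^ i) w = w + i := by
    intro i
    induction i with
    | zero => simp
    | succ i ih => rw [pow_succ, RingHom.mul_def, RingHom.comp_apply, hw, map_add, ih]; simp; ring
  have h1 := h n
  rw [← hσ, pow_orderOf_eq_one, hσ] at h1
  simpa using h1

end Descent

/-! ### The twisted map: its iterates, trace and eigenvectors. -/

section TwistedMap

variable {F : Type*} [Field F]

/-- The semilinear map `(u, v) ↦ (a σ(v), σ(u) + σ(v))`, whose eigenlines correspond to the
solutions of `x (σ(x) + 1) = a`. -/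
def twistedMap (σ : F →+* F) (a : F) : (F × F) →ₛₗ[σ] (F × F) where
  toFun w := (a * σ w.2, σ w.1 + σ w.2)
  map_add' w z := by ext <;> simp <;> ring
  map_smul' t w := by ext <;> simp <;> ring

lemma twistedMap_apply (σ : F →+* F) (a u v : F) :
    twistedMap σ a (u, v) = (a * σ v, σ u + σ v) := rfl

variable {σ : F →+* F} {a : F} {c : ℕ → F}

lemma iterate_twistedMap (h0 : c 0 = 0) (h1 : c 1 = 1)
    (hc : ∀ i, c (i + 2) = c (i + 1) + (σ ^ i) a * c i) (i : ℕ) (u v : F) :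
    (twistedMap σ a)^[i + 1] (u, v) =
      (a * σ (c i) * (σ ^ (i + 1)) u + a * σ (c (i + 1)) * (σ ^ (i + 1)) v,
        c (i + 1) * (σ ^ (i + 1)) u + c (i + 2) * (σ ^ (i + 1)) v) := by
  induction i generalizing u v with
  | zero => simp [twistedMap_apply, h0, h1, hc]
  | succ i ih =>
    have hs : ∀ j x, (σ ^ j) (σ x) = (σ ^ (j + 1)) x := fun j x => by rw [pow_succ]; rfl
    have hs' : ∀ j x, σ ((σ ^ j) x) = (σ ^ (j + 1)) x := fun j x => by rw [pow_succ']; rfl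
    rw [Function.iterate_succ_apply, twistedMap_apply, ih, hc (i + 1)]
    have h2 : σ (c (i + 2)) = σ (c (i + 1)) + (σ ^ (i + 1)) a * σ (c i) := by
      rw [hc, map_add, map_mul, hs']
    ext
    · simp only [map_add, map_mul, hs, h2]; ring
    · simp only [map_add, map_mul, hs]; ring

lemma det_iterate_twistedMap [CharP F 2] (h0 : c 0 = 0) (h1 : c 1 = 1)
    (hc : ∀ i, c (i + 2) = c (i + 1) + (σ ^ i) a * c i) (i : ℕ) :
    a * σ (c i) * c (i + 2) + a * σ (c (i + 1)) * c (i + 1) = sigmaNorm σ (i + 1) a := by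
  induction i with
  | zero => simp [h0, h1, sigmaNorm]
  | succ i ih =>
    have hs' : ∀ j x, σ ((σ ^ j) x) = (σ ^ (j + 1)) x := fun j x => by rw [pow_succ']; rfl
    have h2 : σ (c (i + 2)) = σ (c (i + 1)) + (σ ^ (i + 1)) a * σ (c i) := by
      rw [hc, map_add, map_mul, hs']
    rw [sigmaNorm_succ, ← ih, hc (i + 1), h2]
    linear_combination (a * σ (c (i + 1)) * c (i + 2)) * CharTwo.two_eq_zero (R := F)

/-- The trace of the iterated twisted map in terms of a solution of `x (σ(x) + 1) = a`. -/
lemma trace_eq_of_root [CharP F 2] {n : ℕ} (hσ : orderOf σ = n) (ha : a ≠ 0) {p q r s x : F}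
    (hT : ∀ u v, (twistedMap σ a)^[n] (u, v) = (p * u + q * v, r * u + s * v))
    (hdet : p * s + q * r = sigmaNorm σ n a) (hx : x * (σ x + 1) = a) :
    p + s = sigmaNorm σ n x + sigmaNorm σ n (x + 1) := by
  have hx1 : σ x + 1 ≠ 0 := by rintro h; simp [h] at hx; exact ha hx.symm
  have hfix : ((σ x + 1)⁻¹ • twistedMap σ a) (x, 1) = (x, 1) := by
    ext
    · simp [twistedMap_apply, ← hx]; field_simp
    · simp [twistedMap_apply]; field_simp
  have h := Function.iterate_fixed hfix n
  have hN : sigmaNorm σ n (σ x + 1) = sigmaNorm σ n (x + 1) := by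
    rw [← sigmaNorm_apply hσ (x + 1), map_add, map_one]
  have he : sigmaNorm σ n (x + 1) ≠ 0 := hN ▸ sigmaNorm_ne_zero σ n hx1
  rw [iterate_smul_semilinear, hT, sigmaNorm_inv, hN, inv_smul_eq_iff₀ he] at h
  rw [← hx, sigmaNorm_mul, hN] at hdet
  simp only [Prod.smul_mk, Prod.mk.injEq, smul_eq_mul, mul_one] at h
  obtain ⟨e1, e2⟩ := h
  set e := sigmaNorm σ n (x + 1)
  -- One eigenvalue is `e`, so the other is the determinant divided by `e`.
  apply mul_left_cancel₀ he
  linear_combination r * e1 + hdet - (p + e) * e2 +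
    (e * s - e ^ 2 + e * r * x - r * q) * CharTwo.two_eq_zero (R := F)

/-- If the iterated twisted map has trace zero, then `x (σ(x) + 1) = a` is solvable. -/
lemma exists_root_of_trace_eq_zero [CharP F 2] [Finite F] {n : ℕ} (hσ : orderOf σ = n)
    (hn : 0 < n) (ha : a ≠ 0) {p q r s : F}
    (hT : ∀ u v, (twistedMap σ a)^[n] (u, v) = (p * u + q * v, r * u + s * v))
    (hdet : p * s + q * r = sigmaNorm σ n a) (htr : p + s = 0) :
    ∃ x, x * (σ x + 1) = a := by
  -- With trace zero the characteristic polynomial is `X² + N(b)² = (X + N(b))²`.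
  obtain ⟨b, rfl⟩ : ∃ b, b ^ 2 = a := by
    obtain ⟨b, hb⟩ := FiniteField.isSquare_of_char_two (ringChar.eq F 2 ▸ rfl) a
    exact ⟨b, by rw [hb, sq]⟩
  have hb : b ≠ 0 := by rintro rfl; simp at ha
  have hNb := sigmaNorm_ne_zero σ n hb
  obtain rfl : s = p := by
    have := CharTwo.two_eq_zero (R := F)
    linear_combination htr - p * this
  rw [sq b, sigmaNorm_mul] at hdet
  obtain ⟨w, hw0, hw⟩ : ∃ w : F × F, w ≠ 0 ∧
      (twistedMap σ (b ^ 2))^[n] w = sigmaNorm σ n b • w := by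
    set e := sigmaNorm σ n b
    by_cases h : s + e = 0 ∧ r = 0
    · refine ⟨(1, 0), by simp, ?_⟩
      have : s = e := by linear_combination h.1 - e * CharTwo.two_eq_zero (R := F)
      rw [hT]
      simp [h.2, this]
    -- This is the first column of the iterate plus `e`; that matrix squares to zero by
    -- Cayley–Hamilton, so it kills its own columns.
    · refine ⟨(s + e, r), by simpa [Prod.ext_iff] using h, ?_⟩
      rw [hT]
      ext
      · simp; linear_combination hdet
      · simp; linear_combination r * s * CharTwo.two_eq_zero (R := F)
  obtain ⟨⟨u, v⟩, hv0, hv⟩ := exists_fixed_of_iterate_fixed hσ hn (b⁻¹ • twistedMap σ (b ^ 2)) hw0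
    (by rw [iterate_smul_semilinear, hw, sigmaNorm_inv, inv_smul_smul₀ hNb])
  rw [LinearMap.smul_apply, inv_smul_eq_iff₀ hb, twistedMap_apply] at hv
  simp only [Prod.smul_mk, Prod.mk.injEq, smul_eq_mul] at hv
  obtain ⟨e1, e2⟩ := hv
  have hv : v ≠ 0 := by
    rintro rfl
    simp only [map_zero, mul_zero, zero_eq_mul, hb, false_or] at e1
    simp [e1] at hv0
  have hσv : σ v ≠ 0 := by simpa using hv
  refine ⟨u / v, ?_⟩
  rw [map_div₀, div_add_one hσv, e2]
  have e3 : b * σ v = u := mul_left_cancel₀ hb (by linear_combination e1)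
  field_simp
  linear_combination -e3

end TwistedMap

/-! ### Counting solutions of `x (σ x + 1) = a`. -/

section Counting

open Finset

lemma add_eq_zero_iff_eq_of_char_two {F : Type*} [Field F] [CharP F 2] {x y : F} :
    x + y = 0 ↔ x = y := by
  rw [← CharTwo.sub_eq_add, sub_eq_zero]

lemma mul_apply_add_one_eq_zero {F : Type*} [Field F] [CharP F 2] {σ : F →+* F}
    {x : F} : x * (σ x + 1) = 0 ↔ x = 0 ∨ x = 1 := by
  rw [mul_eq_zero, add_eq_zero_iff_eq_of_char_two, map_eq_one_iff σ σ.injective]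

variable {F : Type*} [Field F]

lemma card_subgroup_units (H : Subgroup Fˣ) (s : Finset F)
    (h : ∀ x, x ∈ s ↔ ∃ u ∈ H, (u : F) = x) : Nat.card H = #s := by
  have hs : Units.val '' (H : Set Fˣ) = (s : Set F) := by
    ext x; exact (h x).symm
  calc Nat.card H = (H : Set Fˣ).ncard := rfl
    _ = (Units.val '' (H : Set Fˣ)).ncard :=
      (Set.ncard_image_of_injective _ Units.val_injective).symm
    _ = #s := by rw [hs, Set.ncard_coe_finset]

variable [Fintype F] [DecidableEq F]

/-- The solutions of `x (σ(x) + 1) = a`. -/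
def solutions (σ : F →+* F) (a : F) : Finset F := {x | x * (σ x + 1) = a}

/-- The solutions of the affine equation `σ(x + 1) σ(u) + x u = 1`. -/
def affineSolutions (σ : F →+* F) (x : F) : Finset F := {u | σ (x + 1) * σ u + x * u = 1}

lemma mem_solutions {σ : F →+* F} {a x : F} : x ∈ solutions σ a ↔ x * (σ x + 1) = a := by
  simp [solutions]

lemma mem_affineSolutions {σ : F →+* F} {x u : F} :
    u ∈ affineSolutions σ x ↔ σ (x + 1) * σ u + x * u = 1 := by
  simp [affineSolutions]

lemma one_lt_card_fixed (σ : F →+* F) : 1 < #{t : F | σ t = t} :=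
  one_lt_card.2 ⟨0, by simp, 1, by simp, zero_ne_one⟩

lemma card_ne_zero_ne_one : (#{x : F | x ≠ 0 ∧ x ≠ 1} : ℚ) = Fintype.card F - 2 := by
  have h : ({x : F | ¬ (x ≠ 0 ∧ x ≠ 1)} : Finset F) = {0, 1} := by
    ext x; simp; tauto
  have := card_filter_add_card_filter_not (s := (univ : Finset F)) (fun x : F => x ≠ 0 ∧ x ≠ 1)
  rw [h, card_pair zero_ne_one, card_univ] at this
  rw [← this]; push_cast; ring

lemma card_ne_zero_eq : (#{x : F | x ≠ 0} : ℚ) = Fintype.card F - 1 := by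
  rw [filter_ne', card_erase_of_mem (mem_univ _), card_univ, Nat.cast_sub Fintype.card_pos]
  simp

variable {σ : F →+* F} {n : ℕ}

/-- By Hilbert 90 the norm-one elements form the image of `u ↦ u / σ u` on units, whose kernel is
the group of fixed units. -/
lemma card_sigmaNorm_eq_one (hσ : orderOf σ = n) (hn : 0 < n) :
    #{t : F | sigmaNorm σ n t = 1} * (#{t : F | σ t = t} - 1) = Fintype.card F - 1 := by
  let φ : Fˣ →* Fˣ := MonoidHom.id Fˣ / Units.map (σ : F →* F)
  have hφ : ∀ u : Fˣ, ((φ u : Fˣ) : F) = u / σ u := fun u => by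
    simp [φ]
  have hker : Nat.card φ.ker = #{t : F | σ t = t} - 1 := by
    rw [← card_erase_of_mem (s := {t : F | σ t = t}) (a := 0) (by simp)]
    refine card_subgroup_units _ _ fun x => ?_
    have hmem : ∀ u : Fˣ, u ∈ φ.ker ↔ σ (u : F) = u := fun u => by
      rw [MonoidHom.mem_ker, ← Units.val_eq_one, hφ,
        div_eq_one_iff_eq ((map_ne_zero σ).2 u.ne_zero), eq_comm]
    simp only [mem_erase, mem_filter, mem_univ, true_and, hmem]
    constructor
    · rintro ⟨hx, h⟩
      exact ⟨Units.mk0 x hx, h, rfl⟩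
    · rintro ⟨u, h, rfl⟩
      exact ⟨u.ne_zero, h⟩
  have hrange : Nat.card φ.range = #{t : F | sigmaNorm σ n t = 1} := by
    refine card_subgroup_units _ _ fun x => ?_
    simp only [mem_filter, mem_univ, true_and]
    constructor
    · intro h
      obtain ⟨u, hu0, hu⟩ := exists_mul_apply_eq_self hσ hn h
      refine ⟨_, ⟨Units.mk0 u hu0, rfl⟩, ?_⟩
      rw [hφ, Units.val_mk0, div_eq_iff ((map_ne_zero σ).2 hu0), hu]
    · rintro ⟨_, ⟨u, rfl⟩, rfl⟩
      rw [hφ, div_eq_mul_inv, sigmaNorm_mul, sigmaNorm_inv, sigmaNorm_apply hσ,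
        mul_inv_cancel₀ (sigmaNorm_ne_zero σ n u.ne_zero)]
  rw [← hker, ← hrange, mul_comm, ← Subgroup.index_ker, Subgroup.card_mul_index,
    Nat.card_eq_fintype_card, Fintype.card_units]

variable [CharP F 2]

lemma mul_add_mul_eq_one_iff {x y : F} (hxy : y + x ≠ 0) :
    (y + x)⁻¹ ∈ affineSolutions σ x ↔ y * (σ y + 1) = x * (σ x + 1) := by
  have h1 : σ y + σ x ≠ 0 := by rw [← map_add]; exact (map_ne_zero σ).2 hxy
  have h2 := CharTwo.two_eq_zero (R := F)
  rw [mem_affineSolutions, map_inv₀, map_add, map_add, map_one]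
  field_simp
  constructor <;> intro h
  · linear_combination -h + y * h2
  · linear_combination -h + y * h2

lemma card_solutions {x a : F} (hx : x * (σ x + 1) = a) :
    #(solutions σ a) = #(affineSolutions σ x) + 1 := by
  rw [← card_erase_add_one (mem_solutions.2 hx)]
  congr 1
  refine card_bij' (fun y _ => (y + x)⁻¹) (fun u _ => u⁻¹ + x) ?_ ?_ ?_ ?_
  · intro y hy
    rw [mem_erase, mem_solutions] at hy
    exact (mul_add_mul_eq_one_iff (by simpa [add_eq_zero_iff_eq_of_char_two] using hy.1)).2
      (hy.2.trans hx.symm)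
  · intro u hu
    have hu0 : u ≠ 0 := by rintro rfl; simp [mem_affineSolutions] at hu
    have h : u⁻¹ + x + x = u⁻¹ := by rw [add_assoc, CharTwo.add_self_eq_zero, add_zero]
    rw [mem_erase, mem_solutions]
    refine ⟨by simpa using hu0, ?_⟩
    rw [← hx]
    refine (mul_add_mul_eq_one_iff (by rw [h]; exact inv_ne_zero hu0)).1 ?_
    rwa [h, inv_inv]
  · intro y _
    rw [inv_inv, add_assoc, CharTwo.add_self_eq_zero, add_zero]
  · intro u _
    rw [add_assoc, CharTwo.add_self_eq_zero, add_zero, inv_inv]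

lemma card_affineSolutions_of_ne (hσ : orderOf σ = n) {x : F}
    (h : sigmaNorm σ n x ≠ sigmaNorm σ n (x + 1)) : #(affineSolutions σ x) = 1 := by
  let L : F →+ F :=
    { toFun := fun u => σ (x + 1) * σ u + x * u
      map_zero' := by simp
      map_add' := fun u v => by simp only [map_add]; ring }
  have hL : Function.Injective L := by
    rw [injective_iff_map_eq_zero]
    intro u hu
    by_contra hu0
    have h1 : σ ((x + 1) * u) = x * u := by
      rw [map_mul]; exact add_eq_zero_iff_eq_of_char_two.1 hu
    have h2 := congrArg (sigmaNorm σ n) h1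
    rw [sigmaNorm_apply hσ, sigmaNorm_mul, sigmaNorm_mul] at h2
    exact h (mul_right_cancel₀ (sigmaNorm_ne_zero σ n hu0) h2).symm
  obtain ⟨u, hu⟩ := Finite.injective_iff_surjective.1 hL 1
  rw [card_eq_one]
  refine ⟨u, ext fun v => ?_⟩
  rw [mem_affineSolutions, mem_singleton]
  exact ⟨fun hv => hL (hv.trans hu.symm), fun hv => hv ▸ hu⟩

/-- Hilbert 90 gives a nonzero `u` solving the homogeneous equation, whose solutions are then the
multiples of `u` by the fixed field. -/
lemma card_affineSolutions_of_eq (hσ : orderOf σ = n) (hn : 0 < n) {x : F} (hx0 : x ≠ 0)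
    (h : sigmaNorm σ n x = sigmaNorm σ n (x + 1)) :
    #(affineSolutions σ x) = 0 ∨ #(affineSolutions σ x) = #{t : F | σ t = t} := by
  have h2 := CharTwo.two_eq_zero (R := F)
  rcases (affineSolutions σ x).eq_empty_or_nonempty with h0 | ⟨v, hv⟩
  · simp [h0]
  right
  obtain ⟨u, hu0, hu⟩ := exists_mul_apply_eq_self hσ hn (t := σ (x + 1) / x) (by
    rw [div_eq_mul_inv, sigmaNorm_mul, sigmaNorm_inv, sigmaNorm_apply hσ, h,
      mul_inv_cancel₀ (h ▸ sigmaNorm_ne_zero σ n hx0)])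
  have hu' : σ (x + 1) * σ u = x * u := by
    rw [div_mul_eq_mul_div, div_eq_iff hx0] at hu
    rw [hu, mul_comm]
  have hx1 : σ (x + 1) ≠ 0 := fun h0 => mul_ne_zero hx0 hu0 (by rw [← hu', h0, zero_mul])
  have hσu : σ u ≠ 0 := by simpa using hu0
  rw [mem_affineSolutions] at hv
  symm
  refine card_bij' (fun t _ => v + t * u) (fun w _ => (w + v) / u) ?_ ?_ ?_ ?_
  · intro t ht
    replace ht : σ t = t := by simpa using ht
    rw [mem_affineSolutions, map_add σ v, map_mul σ t, ht]
    linear_combination hv + t * hu' + t * x * u * h2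
  · intro w hw
    rw [mem_affineSolutions] at hw
    have hw' : σ (w + v) * u = (w + v) * σ u := by
      apply mul_left_cancel₀ (mul_ne_zero hx1 hx0)
      rw [map_add σ w v]
      linear_combination x * u * (hw + hv) - (w + v) * x * hu' - x * u * (x * w + x * v - 1) * h2
    simp only [mem_filter, mem_univ, true_and]
    rw [map_div₀, div_eq_div_iff hσu hu0, hw']
  · intro t _
    field_simp
    linear_combination v * h2
  · intro w _
    field_simp
    linear_combination v * h2

lemma card_solutions_cases (hσ : orderOf σ = n) (hn : 0 < n) {a : F} (ha : a ≠ 0) :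
    #(solutions σ a) = 0 ∨ #(solutions σ a) = 1 ∨ #(solutions σ a) = 2 ∨
      #(solutions σ a) = #{t : F | σ t = t} + 1 := by
  rcases (solutions σ a).eq_empty_or_nonempty with h0 | ⟨x, hx⟩
  · simp [h0]
  rw [mem_solutions] at hx
  have hx0 : x ≠ 0 := by rintro rfl; simp at hx; exact ha hx.symm
  rw [card_solutions hx]
  by_cases h : sigmaNorm σ n x = sigmaNorm σ n (x + 1)
  · rcases card_affineSolutions_of_eq hσ hn hx0 h with h | h <;> simp [h]
  · simp [card_affineSolutions_of_ne hσ h]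

lemma card_solutions_eq_two_iff (hσ : orderOf σ = n) (hn : 0 < n) {a x : F} (ha : a ≠ 0)
    (hx : x * (σ x + 1) = a) :
    #(solutions σ a) = 2 ↔ sigmaNorm σ n x ≠ sigmaNorm σ n (x + 1) := by
  have hx0 : x ≠ 0 := by rintro rfl; simp at hx; exact ha hx.symm
  rw [card_solutions hx]
  have := one_lt_card_fixed σ
  constructor
  · intro h2 h
    rcases card_affineSolutions_of_eq hσ hn hx0 h with h | h <;> omega
  · intro h
    rw [card_affineSolutions_of_ne hσ h]

/-- The involution `x ↦ x / (x + 1)` turns equality of norms into norm one; the value 1 is never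
attained, hence the `+ 1`. -/
lemma card_sigmaNorm_eq (hσ : orderOf σ = n) (hn : 0 < n) :
    #{x : F | (x ≠ 0 ∧ x ≠ 1) ∧ sigmaNorm σ n x = sigmaNorm σ n (x + 1)} + 1 =
      #{t : F | sigmaNorm σ n t = 1} := by
  have h1 : (1 : F) ∈ ({t : F | sigmaNorm σ n t = 1} : Finset F) := by simp [sigmaNorm_one]
  have h2 := CharTwo.two_eq_zero (R := F)
  rw [← card_erase_add_one h1]
  congr 1
  refine card_bij' (fun x _ => x / (x + 1)) (fun t _ => t / (t + 1)) ?_ ?_ ?_ ?_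
  · intro x hx
    simp only [mem_filter, mem_univ, true_and] at hx
    obtain ⟨⟨h0, h1⟩, h⟩ := hx
    have hx1 : x + 1 ≠ 0 := by rwa [Ne, add_eq_zero_iff_eq_of_char_two]
    simp only [mem_erase, mem_filter, mem_univ, true_and]
    refine ⟨fun h => ?_, ?_⟩
    · rw [div_eq_one_iff_eq hx1] at h; simp at h
    · rw [div_eq_mul_inv, sigmaNorm_mul, sigmaNorm_inv, h,
        mul_inv_cancel₀ (sigmaNorm_ne_zero σ n hx1)]
  · intro t ht
    simp only [mem_erase, mem_filter, mem_univ, true_and] at ht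
    obtain ⟨h1, h⟩ := ht
    have ht0 : t ≠ 0 := by
      rintro rfl
      obtain ⟨m, rfl⟩ := Nat.exists_eq_succ_of_ne_zero hn.ne'
      simp [sigmaNorm_succ'] at h
    have ht1 : t + 1 ≠ 0 := by rwa [Ne, add_eq_zero_iff_eq_of_char_two]
    simp only [mem_filter, mem_univ, true_and]
    refine ⟨⟨div_ne_zero ht0 ht1, fun h => ?_⟩, ?_⟩
    · rw [div_eq_one_iff_eq ht1] at h; simp at h
    · have : t / (t + 1) + 1 = (t + 1)⁻¹ := by field_simp; linear_combination t * h2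
      rw [this, div_eq_mul_inv, sigmaNorm_mul, h, one_mul]
  · intro x hx
    simp only [mem_filter, mem_univ, true_and] at hx
    have hx1 : x + 1 ≠ 0 := by rw [Ne, add_eq_zero_iff_eq_of_char_two]; exact hx.1.2
    have : x / (x + 1) + 1 = (x + 1)⁻¹ := by field_simp; linear_combination x * h2
    rw [this]; field_simp
  · intro x hx
    simp only [mem_erase, mem_filter, mem_univ, true_and] at hx
    have hx1 : x + 1 ≠ 0 := by rw [Ne, add_eq_zero_iff_eq_of_char_two]; exact hx.1
    have : x / (x + 1) + 1 = (x + 1)⁻¹ := by field_simp; linear_combination x * h2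
    rw [this]; field_simp

lemma card_apply_add_self_eq_one (hσ : orderOf σ = n) (hn : 0 < n) :
    #{w : F | σ w + w = 1} = if Even n then #{t : F | σ t = t} else 0 := by
  have h2 := CharTwo.two_eq_zero (R := F)
  have key : ∀ w : F, σ w + w = 1 ↔ σ w = w + 1 := fun w =>
    ⟨fun h => by linear_combination h - w * h2, fun h => by linear_combination h + w * h2⟩
  have hpar : (n : F) = 0 ↔ Even n := by rw [CharP.cast_eq_zero_iff F 2, even_iff_two_dvd]
  split_ifs with h
  · obtain ⟨w, hw⟩ := exists_apply_eq_add_one hσ hn (hpar.2 h)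
    refine card_bij' (fun v _ => v - w) (fun t _ => t + w) ?_ ?_ ?_ ?_
    · intro v hv
      simp only [key, mem_filter, mem_univ, true_and] at hv ⊢
      rw [map_sub, hv, hw]; ring
    · intro t ht
      simp only [key, mem_filter, mem_univ, true_and] at ht ⊢
      rw [map_add, ht, hw]; ring
    · simp
    · simp
  · rw [card_eq_zero, filter_eq_empty_iff]
    exact fun w _ hw => h (hpar.1 (natCast_eq_zero_of_apply_eq_add_one hσ ((key w).1 hw)))

/-- With `w = x u` the affine equation reads `σ u = 1 + σ w + w`, so `w` determines the pair `(x,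
u)`, which exists unless `σ w + w = 1` forces `u = 0`. -/
lemma sum_card_affineSolutions_univ :
    ∑ x : F, #(affineSolutions σ x) + #{w : F | σ w + w = 1} = Fintype.card F := by
  have hsurj : Function.Surjective σ := Finite.injective_iff_surjective.1 σ.injective
  have h2 := CharTwo.two_eq_zero (R := F)
  have h : ∑ x : F, #(affineSolutions σ x) = #{w : F | ¬ σ w + w = 1} := by
    rw [← card_sigma]
    refine card_bij (fun p _ => p.1 * p.2) ?_ ?_ ?_
    · rintro ⟨x, u⟩ hu
      have hu := mem_affineSolutions.1 (mem_sigma.1 hu).2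
      have hu0 : u ≠ 0 := by rintro rfl; simp at hu
      simp only [mem_filter, mem_univ, true_and, map_mul]
      simp only [map_add, map_one] at hu
      intro h
      refine (map_ne_zero σ).2 hu0 ?_
      linear_combination hu - h
    · rintro ⟨x, u⟩ hu ⟨y, v⟩ hv h
      have hu := mem_affineSolutions.1 (mem_sigma.1 hu).2
      have hv := mem_affineSolutions.1 (mem_sigma.1 hv).2
      have hu0 : u ≠ 0 := by rintro rfl; simp at hu
      simp only [map_add, map_one] at hu hv h
      have hσ := congrArg σ h
      simp only [map_mul] at hσ
      obtain rfl : u = v := σ.injective (by linear_combination hu - hv - h - hσ)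
      rw [mul_right_cancel₀ hu0 h]
    · intro w hw
      simp only [mem_filter, mem_univ, true_and] at hw
      obtain ⟨u, hu⟩ := hsurj (1 + (σ w + w))
      have hu0 : u ≠ 0 := by
        rintro rfl
        rw [map_zero, eq_comm, add_eq_zero_iff_eq_of_char_two] at hu
        exact hw hu.symm
      have hσu : σ u ≠ 0 := (map_ne_zero σ).2 hu0
      refine ⟨⟨w / u, u⟩, mem_sigma.2 ⟨mem_univ _, mem_affineSolutions.2 ?_⟩, ?_⟩
      · rw [map_add, map_div₀, map_one]
        field_simp
        linear_combination hu + (σ w + w) * h2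
      · simp [hu0]
  rw [h, add_comm, card_filter_add_card_filter_not, card_univ]

lemma sum_card_affineSolutions :
    ∑ x : F with x ≠ 0 ∧ x ≠ 1, #(affineSolutions σ x) + 2 + #{w : F | σ w + w = 1} =
      Fintype.card F := by
  rw [← sum_card_affineSolutions_univ (σ := σ),
    ← sum_filter_add_sum_filter_not univ (fun x : F => x ≠ 0 ∧ x ≠ 1)]
  have h : ({x : F | ¬ (x ≠ 0 ∧ x ≠ 1)} : Finset F) = {0, 1} := by
    ext x; simp; tauto
  have h0 : affineSolutions σ 0 = {1} := by
    ext u; simp [mem_affineSolutions, map_eq_one_iff σ σ.injective]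
  have h1 : affineSolutions σ 1 = {1} := by
    ext u; simp [mem_affineSolutions, CharTwo.add_self_eq_zero]
  rw [h, sum_pair zero_ne_one, h0, h1]
  simp

/-- Summation over the fibres of `x ↦ x (σ(x) + 1)`. -/
lemma sum_comp_mul_apply_add_one (g : F → ℚ) :
    ∑ x : F with x ≠ 0 ∧ x ≠ 1, g (x * (σ x + 1)) =
      ∑ a : F with a ≠ 0, (#(solutions σ a) : ℚ) * g a := by
  rw [← sum_fiberwise_of_maps_to (s := ({x : F | x ≠ 0 ∧ x ≠ 1} : Finset F))
    (t := ({a : F | a ≠ 0} : Finset F)) (g := fun x => x * (σ x + 1))]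
  · refine sum_congr rfl fun a ha => ?_
    simp only [mem_filter, mem_univ, true_and] at ha
    have hs : ({x ∈ ({x : F | x ≠ 0 ∧ x ≠ 1} : Finset F) | x * (σ x + 1) = a} : Finset F) =
        solutions σ a := by
      ext x
      simp only [mem_filter, mem_univ, true_and, mem_solutions, and_iff_right_iff_imp]
      rintro rfl
      simpa only [Ne, mul_apply_add_one_eq_zero, not_or] using ha
    rw [hs, sum_congr rfl (fun x hx => by rw [mem_solutions.1 hx]), sum_const, nsmul_eq_mul]
  · intro x hx
    simpa only [mem_filter, mem_univ, true_and, Ne, mul_apply_add_one_eq_zero, not_or] using hx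

/-- Each such `a` accounts for two `x` outside `{0, 1}` with `N(x) ≠ N(x + 1)`. -/
lemma card_two_solutions (hσ : orderOf σ = n) (hn : 0 < n) :
    2 * (#{a : F | a ≠ 0 ∧ #(solutions σ a) = 2} : ℚ) * (#{t : F | σ t = t} - 1) =
      (Fintype.card F - 1) * (#{t : F | σ t = t} - 2) := by
  have h1 := sum_comp_mul_apply_add_one (σ := σ)
    (fun a => if #(solutions σ a) = 2 then 1 else 0)
  have h2 : ∑ a : F with a ≠ 0, (#(solutions σ a) : ℚ) * (if #(solutions σ a) = 2 then 1 else 0) =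
      2 * #{a : F | a ≠ 0 ∧ #(solutions σ a) = 2} := by
    rw [← filter_filter, card_filter, Nat.cast_sum, mul_sum]
    refine sum_congr rfl fun a _ => ?_
    split_ifs with h <;> simp [h]
  have h3 : ∑ x : F with x ≠ 0 ∧ x ≠ 1,
      (if #(solutions σ (x * (σ x + 1))) = 2 then (1 : ℚ) else 0) =
      #{x : F | (x ≠ 0 ∧ x ≠ 1) ∧ ¬ sigmaNorm σ n x = sigmaNorm σ n (x + 1)} := by
    rw [← filter_filter (fun x : F => x ≠ 0 ∧ x ≠ 1), card_filter, Nat.cast_sum]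
    refine sum_congr rfl fun x hx => ?_
    simp only [mem_filter, mem_univ, true_and] at hx
    simp [card_solutions_eq_two_iff hσ hn
      (by rw [Ne, mul_apply_add_one_eq_zero, not_or]; exact hx) rfl]
  have h4 := card_filter_add_card_filter_not (s := ({x : F | x ≠ 0 ∧ x ≠ 1} : Finset F))
    (fun x : F => sigmaNorm σ n x = sigmaNorm σ n (x + 1))
  rw [filter_filter, filter_filter] at h4
  have h5 := card_sigmaNorm_eq hσ hn
  have h6 := card_sigmaNorm_eq_one hσ hn
  have h7 := card_ne_zero_ne_one (F := F)
  have h8 := one_lt_card_fixed σ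
  rw [h2, h3] at h1
  zify [h8.le, Fintype.card_pos (α := F)] at h4 h5 h6
  qify at h4 h5 h6
  rw [← h1]
  rw [← h5] at h6
  linear_combination (#{t : F | σ t = t} - 1 : ℚ) * (h4 + h7) - h6

lemma card_no_solutions (hσ : orderOf σ = n) (hn : 0 < n) :
    2 * (#{a : F | a ≠ 0 ∧ #(solutions σ a) = 0} : ℚ) * (#{t : F | σ t = t} + 1) =
      (Fintype.card F + (if Even n then -1 else 1)) * #{t : F | σ t = t} := by
  have h1 := sum_comp_mul_apply_add_one (σ := σ) (fun _ => 1)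
  have h2 := sum_comp_mul_apply_add_one (σ := σ) (fun a => #(solutions σ a) - 1)
  have h3 := card_two_solutions hσ hn
  have h4 := sum_card_affineSolutions (σ := σ)
  rw [card_apply_add_self_eq_one hσ hn] at h4
  have h5 : ∑ x : F with x ≠ 0 ∧ x ≠ 1, ((#(solutions σ (x * (σ x + 1))) : ℚ) - 1) =
      (∑ x : F with x ≠ 0 ∧ x ≠ 1, #(affineSolutions σ x) : ℕ) := by
    rw [Nat.cast_sum]
    exact sum_congr rfl fun x _ => by rw [card_solutions rfl]; simp
  rw [h5] at h2
  set Q := #{t : F | σ t = t}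
  -- Summed from an identity for each `a`: if `s` is its number of solutions, then `(Q+1)[s=0] =
  -- (Q+1)(1 - s + [s=2]) + s(s-1) - 2[s=2]` for each of `s = 0, 1, 2, Q+1`.
  have key : (Q + 1 : ℚ) * #{a : F | a ≠ 0 ∧ #(solutions σ a) = 0} =
      (Q + 1) * (#{a : F | a ≠ 0} - ∑ a : F with a ≠ 0, (#(solutions σ a) : ℚ) * 1 +
        #{a : F | a ≠ 0 ∧ #(solutions σ a) = 2}) +
      ∑ a : F with a ≠ 0, (#(solutions σ a) : ℚ) * (#(solutions σ a) - 1) -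
      2 * #{a : F | a ≠ 0 ∧ #(solutions σ a) = 2} := by
    rw [← filter_filter, ← filter_filter, card_filter, card_filter _ (filter _ _),
      card_eq_sum_ones]
    push_cast
    rw [← sum_sub_distrib, ← sum_add_distrib, mul_sum, mul_sum, mul_sum, ← sum_add_distrib,
      ← sum_sub_distrib]
    refine sum_congr rfl fun a ha => ?_
    have hQ := one_lt_card_fixed σ
    rcases card_solutions_cases hσ hn (a := a) (by simpa using ha) with h | h | h | h
    · simp [h]
    · simp [h]
    · simp [h]; norm_num
    · have h' : #(solutions σ a) ≠ 2 := by omega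
      rw [if_neg h', if_neg (by omega), h]
      push_cast
      ring
  rw [← h1, ← h2, card_ne_zero_eq, sum_const, nsmul_eq_mul, card_ne_zero_ne_one] at key
  qify at h4
  push_cast at key
  split_ifs at h4 ⊢
  · linear_combination 2 * key + h3 + 2 * h4
  · linear_combination 2 * key + h3 + 2 * h4

end Counting

/-! ### Specialization to the Frobenius power `x ↦ x ^ 2 ^ l`. -/

section Frobenius

variable {F : Type*} [Field F]

lemma iterateFrobenius_pow_apply [CharP F 2] (l i : ℕ) (x : F) :
    (iterateFrobenius F 2 l ^ i) x = x ^ 2 ^ (i * l) := by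
  rw [RingHom.coe_pow, ← coe_iterateFrobenius_mul, iterateFrobenius_def, mul_comm]

/-- The placeholder `C_0 = 0` makes the recurrence hold from `i = 0`. -/
lemma eval_CPoly_add_two [CharP F 2] (l : ℕ) (a : F) (i : ℕ) :
    (CPoly F l (i + 2)).eval a = (CPoly F l (i + 1)).eval a +
      (iterateFrobenius F 2 l ^ i) a * (CPoly F l i).eval a := by
  rw [iterateFrobenius_pow_apply]
  cases i <;> simp [CPoly]

variable [Fintype F] [DecidableEq F]

lemma card_pow_two_pow_eq_self {k m : ℕ} (hF : Nat.card F = 2 ^ k) :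
    Finset.card {x : F | x ^ 2 ^ m = x} = 2 ^ Nat.gcd m k := by
  have hpos : 2 ^ m ≠ 0 := by positivity
  rw [← Finset.card_erase_add_one (s := {x : F | x ^ 2 ^ m = x}) (a := 0) (by simp),
    ← card_subgroup_units (powMonoidHom (2 ^ m - 1) : Fˣ →* Fˣ).ker, IsCyclic.card_powMonoidHom_ker,
    Nat.card_units, hF, Nat.pow_sub_one_gcd_pow_sub_one, Nat.gcd_comm,
    Nat.sub_add_cancel Nat.one_le_two_pow]
  have h : ∀ x : F, x ^ 2 ^ m = x ^ (2 ^ m - 1) * x := fun x => by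
    rw [← pow_succ, Nat.sub_add_cancel Nat.one_le_two_pow]
  intro x
  simp only [Finset.mem_erase, Finset.mem_filter, Finset.mem_univ, true_and, MonoidHom.mem_ker,
    powMonoidHom_apply]
  constructor
  · rintro ⟨hx, hx'⟩
    refine ⟨Units.mk0 x hx, Units.ext ?_, rfl⟩
    simpa [h, hx] using hx'
  · rintro ⟨u, hu, rfl⟩
    refine ⟨u.ne_zero, ?_⟩
    rw [h, ← Units.val_pow_eq_pow_val, hu, Units.val_one, one_mul]

/-- The `i`-th power is trivial iff its fixed field is all of `F`, iff `k ∣ i * l`, iff `n ∣ i`,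
because `l / d` is coprime to `n`. -/
lemma orderOf_iterateFrobenius [CharP F 2] {k l d n : ℕ} (hl : 0 < l) (hd : d = Nat.gcd l k)
    (hn : k = n * d) (hF : Nat.card F = 2 ^ k) : orderOf (iterateFrobenius F 2 l) = n := by
  have key : ∀ i, iterateFrobenius F 2 l ^ i = 1 ↔ n ∣ i := by
    intro i
    have h1 : iterateFrobenius F 2 l ^ i = 1 ↔ ∀ x : F, x ^ 2 ^ (i * l) = x := by
      rw [RingHom.ext_iff]
      simp only [iterateFrobenius_pow_apply, RingHom.one_def, RingHom.id_apply]
    have hd0 : 0 < d := hd ▸ Nat.gcd_pos_of_pos_left k hl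
    obtain ⟨m, hm⟩ : d ∣ l := hd ▸ Nat.gcd_dvd_left l k
    have hcop : Nat.Coprime n m := by
      have h : d * Nat.gcd m n = d * 1 := by
        rw [← Nat.gcd_mul_left, ← hm, mul_comm d n, ← hn, ← hd, mul_one]
      exact (Nat.coprime_comm.1 (Nat.eq_of_mul_eq_mul_left hd0 h))
    calc iterateFrobenius F 2 l ^ i = 1 ↔ ∀ x : F, x ^ 2 ^ (i * l) = x := h1
      _ ↔ Finset.card {x : F | x ^ 2 ^ (i * l) = x} = Fintype.card F := by
        rw [← Finset.card_univ, Finset.card_filter_eq_iff]; simp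
      _ ↔ k ∣ i * l := by
        rw [card_pow_two_pow_eq_self hF, ← Nat.card_eq_fintype_card, hF,
          Nat.pow_right_inj one_lt_two, Nat.gcd_eq_right_iff_dvd]
      _ ↔ n ∣ i := by
        rw [hm, hn, mul_left_comm, mul_comm n d, Nat.mul_dvd_mul_iff_left hd0]
        exact hcop.dvd_mul_right
  exact Nat.dvd_antisymm (orderOf_dvd_of_pow_eq_one ((key n).2 dvd_rfl))
    ((key _).1 (pow_orderOf_eq_one _))

lemma numZeros_eq_card_solutions [CharP F 2] (l : ℕ) (a : F) :
    numZeros l a = (solutions (iterateFrobenius F 2 l) a).card := by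
  rw [numZeros, ← Set.ncard_coe_finset]
  congr 1
  ext x
  simp only [P, eval_add, eval_pow, eval_X, eval_C, Set.mem_ofPred_eq, Finset.mem_coe,
    mem_solutions, iterateFrobenius_def]
  rw [add_eq_zero_iff_eq_of_char_two, mul_add, mul_one, pow_succ']

lemma M_eq_card [CharP F 2] (l i : ℕ) :
    M F l i =
      Finset.card {a : F | a ≠ 0 ∧ (solutions (iterateFrobenius F 2 l) a).card = i} := by
  rw [M, ← Set.ncard_coe_finset]
  congr 1
  ext a
  simp [numZeros_eq_card_solutions]

/-- `P_a` has no zeros or exactly two zeros precisely when `Z_n(a)` does not vanish. -/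
lemma numZeros_eq_zero_or_two_iff [CharP F 2] {l m : ℕ}
    (hσ : orderOf (iterateFrobenius F 2 l) = m + 2) {a : F} (ha : a ≠ 0) :
    (numZeros l a = 0 ∨ numZeros l a = 2) ↔ (ZPoly F l (m + 2)).eval a ≠ 0 := by
  set σ := iterateFrobenius F 2 l with hσdef
  let c : ℕ → F := fun i => (CPoly F l i).eval a
  have h0 : c 0 = 0 := by simp [c, CPoly]
  have h1 : c 1 = 1 := by simp [c, CPoly]
  have hc : ∀ i, c (i + 2) = c (i + 1) + (σ ^ i) a * c i := eval_CPoly_add_two l a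
  have hZ : (ZPoly F l (m + 2)).eval a = a * σ (c (m + 1)) + c (m + 3) := by
    simp [ZPoly, c, hσdef, iterateFrobenius_def, add_comm]
  have hid : ∀ x, (σ ^ (m + 1 + 1)) x = x := fun x => by
    rw [← hσ, pow_orderOf_eq_one]; rfl
  have hT : ∀ u v, (twistedMap σ a)^[m + 2] (u, v) =
      (a * σ (c (m + 1)) * u + a * σ (c (m + 2)) * v, c (m + 2) * u + c (m + 3) * v) := by
    intro u v
    have := iterate_twistedMap h0 h1 hc (m + 1) u v
    rwa [hid, hid] at this
  have hdet := det_iterate_twistedMap h0 h1 hc (m + 1)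
  have hn : 0 < m + 2 := by omega
  rw [hZ, numZeros_eq_card_solutions, ← hσdef]
  constructor
  · intro h htr
    obtain ⟨x, hx⟩ := exists_root_of_trace_eq_zero hσ hn ha hT hdet htr
    rcases h with h | h
    · rw [Finset.card_eq_zero] at h
      exact Finset.notMem_empty x (h ▸ mem_solutions.2 hx)
    · rw [card_solutions_eq_two_iff hσ hn ha hx] at h
      rw [trace_eq_of_root hσ ha hT hdet hx] at htr
      exact h (add_eq_zero_iff_eq_of_char_two.1 htr)
  · intro htr
    rcases (solutions σ a).eq_empty_or_nonempty with h | ⟨x, hx⟩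
    · exact Or.inl (by rw [h, Finset.card_empty])
    · rw [mem_solutions] at hx
      rw [trace_eq_of_root hσ ha hT hdet hx] at htr
      exact Or.inr ((card_solutions_eq_two_iff hσ hn ha hx).2
        fun h => htr (add_eq_zero_iff_eq_of_char_two.2 h))

end Frobenius

end HellesethKholosha

theorem mainTheorem2 (l k d n : ℕ) (hl : 0 < l) (hlk : l < k) (hd : d = Nat.gcd l k)
    (hn : k = n * d) (F : Type*) [Field F] (hF : Nat.card F = 2 ^ k) :
    (∀ a : F, a ≠ 0 →
      ((HellesethKholosha.numZeros l a = 0 ∨ HellesethKholosha.numZeros l a = 2) ↔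
        (HellesethKholosha.ZPoly F l n).eval a ≠ 0)) ∧
    (Odd n →
      (HellesethKholosha.M F l 0 : ℚ) = (2 ^ k + 1) * 2 ^ (d - 1) / (2 ^ d + 1) ∧
      (HellesethKholosha.M F l 2 : ℚ) = (2 ^ k - 1) * (2 ^ (d - 1) - 1) / (2 ^ d - 1)) ∧
    (Even n →
      (HellesethKholosha.M F l 0 : ℚ) = (2 ^ k - 1) * 2 ^ (d - 1) / (2 ^ d + 1) ∧
      (HellesethKholosha.M F l 2 : ℚ) = (2 ^ k - 1) * (2 ^ (d - 1) - 1) / (2 ^ d - 1)) := by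
  classical
  have : Finite F := Nat.finite_of_card_ne_zero (by rw [hF]; positivity)
  have := Fintype.ofFinite F
  have hF' : Fintype.card F = 2 ^ k := by rw [← Nat.card_eq_fintype_card, hF]
  have : CharP F 2 := charP_of_card_eq_prime_pow hF'
  have hσ := HellesethKholosha.orderOf_iterateFrobenius (F := F) hl hd hn hF
  have hdl : d ≤ l := hd ▸ Nat.gcd_le_left k hl
  have hd0 : 0 < d := hd ▸ Nat.gcd_pos_of_pos_left k hl
  -- Since `d ≤ l < k = n * d`, `n` is at least 2, so `ZPoly` is in its generic clause.
  obtain ⟨m, rfl⟩ : ∃ m, n = m + 2 := by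
    refine Nat.exists_eq_add_of_le' ?_
    by_contra h
    interval_cases n <;> omega
  have hn0 : 0 < m + 2 := by omega
  have hQ : (Finset.card {t : F | iterateFrobenius F 2 l t = t} : ℚ) = 2 ^ d := by
    have h : Finset.card {t : F | iterateFrobenius F 2 l t = t} = 2 ^ d := by
      rw [hd, ← HellesethKholosha.card_pow_two_pow_eq_self hF]
      congr 1
    exact_mod_cast h
  have hd2 : (2 : ℚ) ^ d = 2 * 2 ^ (d - 1) := by rw [← pow_succ', Nat.sub_add_cancel hd0]
  have hQ1 : (2 : ℚ) ^ d - 1 ≠ 0 := by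
    have : (1 : ℚ) < 2 ^ d := one_lt_pow₀ (by norm_num) hd0.ne'
    linarith
  have hQ2 : (2 : ℚ) ^ d + 1 ≠ 0 := by positivity
  have h0 := HellesethKholosha.card_no_solutions hσ hn0
  have h2 := HellesethKholosha.card_two_solutions hσ hn0
  rw [← HellesethKholosha.M_eq_card, hQ, hF'] at h0 h2
  push_cast at h0 h2
  have hM2 : (HellesethKholosha.M F l 2 : ℚ) =
      (2 ^ k - 1) * (2 ^ (d - 1) - 1) / (2 ^ d - 1) := by
    rw [eq_div_iff hQ1]
    linear_combination h2 / 2 + (2 ^ k - 1) / 2 * hd2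
  refine ⟨fun a ha => HellesethKholosha.numZeros_eq_zero_or_two_iff hσ ha,
    fun hodd => ⟨?_, hM2⟩, fun heven => ⟨?_, hM2⟩⟩
  · rw [if_neg (Nat.not_even_iff_odd.2 hodd)] at h0
    rw [eq_div_iff hQ2]
    linear_combination h0 / 2 + (2 ^ k + 1) / 2 * hd2
  · rw [if_pos heven] at h0
    rw [eq_div_iff hQ2]
    linear_combination h0 / 2 + (2 ^ k - 1) / 2 * hd2
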